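/- Let $d\ge 1$, let $(\mathcal S,\|\cdot\|)$ be a real normed space with its Borel $\sigma$-algebra, and let $\mathcal M$ be the set of point measures $\gamma=\sum_i\delta_{(x_i,m_i)}$ on $\mathbb R^d\times\mathcal S$ with $\gamma(\Lambda\times\mathcal S)<\infty$ for every bounded $\Lambda\subset\mathbb R^d$, endowed with the $\sigma$-algebra generated by the maps $\gamma\mapsto\gamma(\Lambda\times A)$, with $\Lambda\subset\mathbb R^d$ bounded Borel and $A\subset\mathcal S$ Borel. Write $(x,m)\in\gamma$ if $(x,m)$ is an atom of $\gamma$, $\gamma_\Lambda$ for the restriction of $\gamma$ to $\Lambda\times\mathcal S$, $\langle\gamma,f\rangle=\int f\,d\gamma$, $\mathcal M_f$ for the set of finite $\gamma\in\mathcal M$, $\theta_y$ for the translation of locations by $y\in\mathbb R^d$, and $B(x,r)$ for the open Euclidean ball. Let $R$ be a probability measure on $\mathcal S$ and $\delta>0$ with $\int e^{\|m\|^{d+2\delta}}R(dm)<\infty$, and let $z>0$. Let $H:\mathcal M_f\to\mathbb R\cup\{+\infty\}$ be measurable and translation-invariant, with value $0$ at the empty configuration, and suppose that for some $c\ge 0$,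 $$H(\gamma)\ge -c\,\langle\gamma,1+\|m\|^{d+\delta}\rangle\qquad\text{for all }\gamma\in\mathcal M_f .$$ For $n\ge1$ let $\Lambda_n=[-n,n)^d$, let $\pi^z_{\Lambda_n}$ be the law of the Poisson point process on $\mathbb R^d\times\mathcal S$ with intensity measure $z\,\mathbf 1_{\Lambda_n}(x)\,dx\otimes R(dm)$, and let $$P_n(d\gamma)=\frac1{Z_n}\,e^{-H(\gamma_{\Lambda_n})}\,\pi^z_{\Lambda_n}(d\gamma),\qquad Z_n=\int e^{-H(\gamma_{\Lambda_n})}\,\pi^z_{\Lambda_n}(d\gamma).$$ Let $\tilde P_n$ be the probability measure on $\mathcal M$ under which the configurations in the disjoint blocks $\Lambda_n+2n\kappa$, $\kappa\in\mathbb Z^d$, are independent, each distributed as the translate by $2n\kappa$ of $P_n$, and let $$\bar P_n=\frac1{(2n)^d}\sum_{\kappa\in\Lambda_n\cap\mathbb Z^d}\tilde P_n\circ\theta_\kappa^{-1}.$$ A configuration $\gamma\in\mathcal M$ is called tempered, $\gamma\in\mathcal M^{\mathrm{temp}}$, if there is $t\in\mathbb N$ with $\langle\gamma_{B(0,j)},1+\|m\|^{d+\delta}\rangle\le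 t\,j^d$ for all integers $j\ge1$. For an integer $l\ge1$ let $$\underline{\mathcal M}^l=\Big\{\gamma\in\mathcal M^{\mathrm{temp}}:\ \text{for all integers }k\ge l\text{ and all }(x,m)\in\gamma\text{ with }x\notin B(0,2k+1),\ B(x,\|m\|)\cap B(0,k)=\emptyset\Big\}.$$ Then for every $\epsilon>0$ there exists an integer $l\ge1$ such that $$\bar P_n\big(\underline{\mathcal M}^l\big)\ge 1-\epsilon\qquad\text{for all }n\ge1 .$$ -/

import Mathlib

open MeasureTheory Set
open scoped ENNReal NNReal Nat

noncomputable section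

namespace MarkedGibbs

/-- Location space `ℝ^d` with the Euclidean norm. -/
abbrev Loc (d : ℕ) : Type := EuclideanSpace ℝ (Fin d)

/-- State space `ℝ^d × S` of marked points, with the product `σ`-algebra. -/
abbrev Pt (d : ℕ) (S : Type*) : Type _ := Loc d × S

/-- The half-open centred cube `[-n, n)^d`. -/
def cube (d n : ℕ) : Set (Loc d) := {x | ∀ i, -(n : ℝ) ≤ x i ∧ x i < n}

/-- The lattice point `κ ∈ ℤ^d`, seen in `ℝ^d`. -/
def latticePt {d : ℕ} (κ : Fin d → ℤ) : Loc d := WithLp.toLp 2 fun i => (κ i : ℝ)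

theorem isBounded_cube (d n : ℕ) : Bornology.IsBounded (cube d n) := by
  refine (PiLp.antilipschitzWith_ofLp 2 (fun _ : Fin d => ℝ)).isBounded_preimage
    (s := Set.Icc (fun _ => -(n : ℝ)) (fun _ => (n : ℝ))) (Metric.isBounded_Icc _ _) |>.subset ?_
  intro x hx
  exact ⟨fun i => (hx i).1, fun i => (hx i).2.le⟩

section Config

variable {d : ℕ} {S : Type*} [MeasurableSpace S]

/-- A point measure on `ℝ^d × S`: a countable sum of Dirac masses with only finitely many points
over every bounded set of locations. -/
def IsPointMeasure (μ : Measure (Pt d S)) : Prop :=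
  (∃ (ι : Type) (_ : Countable ι) (p : ι → Pt d S),
      μ = Measure.sum fun i => Measure.dirac (p i)) ∧
    ∀ Λ : Set (Loc d), Bornology.IsBounded Λ → μ (Λ ×ˢ univ) < ∞

variable (d S) in
/-- The space `𝓜` of configurations (point measures on `ℝ^d × S`). -/
structure Config where
  /-- the point measure -/
  toMeasure : Measure (Pt d S)
  isPointMeasure : IsPointMeasure toMeasure

/-- The `σ`-algebra on `𝓜` generated by the counting maps `γ ↦ γ(Λ × A)`, for `Λ` bounded Borel
and `A` Borel. -/
instance : MeasurableSpace (Config d S) :=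
  ⨆ (Λ : Set (Loc d)) (_ : MeasurableSet Λ ∧ Bornology.IsBounded Λ) (A : Set S)
    (_ : MeasurableSet A),
    MeasurableSpace.comap (fun γ : Config d S => γ.toMeasure (Λ ×ˢ A)) inferInstance

/-- `p ∈ γ`: the point `p` is an atom of `γ`. -/
instance : Membership (Pt d S) (Config d S) := ⟨fun γ p => γ.toMeasure {p} ≠ 0⟩

variable (d S) in
/-- The space `𝓜_f` of finite configurations. -/
structure FinConfig where
  /-- the underlying configuration -/
  toConfig : Config d S
  measure_univ_lt_top : toConfig.toMeasure univ < ∞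

instance : MeasurableSpace (FinConfig d S) :=
  MeasurableSpace.comap FinConfig.toConfig inferInstance

theorem isPointMeasure_restrict [MeasurableSingletonClass S] {μ : Measure (Pt d S)}
    (h : IsPointMeasure μ) (Λ : Set (Loc d)) : IsPointMeasure (μ.restrict (Λ ×ˢ univ)) := by
  classical
  obtain ⟨⟨ι, hι, p, rfl⟩, hfin⟩ := h
  refine ⟨⟨↥{i : ι | p i ∈ Λ ×ˢ (univ : Set S)}, inferInstance, fun i => p i, ?_⟩,
    fun Δ hΔ => lt_of_le_of_lt (Measure.restrict_apply_le _ _) (hfin Δ hΔ)⟩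
  ext s hs
  rw [Measure.restrict_sum_of_countable, Measure.sum_apply _ hs, Measure.sum_apply _ hs]
  simp_rw [restrict_dirac]
  rw [tsum_subtype {i : ι | p i ∈ Λ ×ˢ (univ : Set S)} fun i => Measure.dirac (p i) s]
  refine tsum_congr fun i => ?_
  by_cases hi : p i ∈ Λ ×ˢ (univ : Set S)
  · rw [if_pos hi, Set.indicator_of_mem (show i ∈ {i : ι | p i ∈ Λ ×ˢ (univ : Set S)} from hi)]
  · rw [if_neg hi, Set.indicator_of_notMem
      (show i ∉ {i : ι | p i ∈ Λ ×ˢ (univ : Set S)} from hi)]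
    rfl

/-- `γ_Λ`, the restriction of `γ` to `Λ × S`. -/
def Config.restrict [MeasurableSingletonClass S] (γ : Config d S) (Λ : Set (Loc d)) :
    Config d S :=
  ⟨γ.toMeasure.restrict (Λ ×ˢ univ), isPointMeasure_restrict γ.isPointMeasure Λ⟩

/-- `γ_Λ` for bounded `Λ`, as a finite configuration. -/
def Config.restrictFin [MeasurableSingletonClass S] (γ : Config d S) (Λ : Set (Loc d))
    (hΛ : Bornology.IsBounded Λ) : FinConfig d S :=
  ⟨γ.restrict Λ, by
    change γ.1.restrict (Λ ×ˢ univ) univ < ∞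
    rw [Measure.restrict_apply_univ]
    exact γ.2.2 Λ hΛ⟩

theorem measurable_shift (y : Loc d) :
    Measurable fun p : Pt d S => ((p.1 + y, p.2) : Pt d S) := by fun_prop

theorem isPointMeasure_map_shift {μ : Measure (Pt d S)} (h : IsPointMeasure μ) (y : Loc d) :
    IsPointMeasure (μ.map fun p : Pt d S => ((p.1 + y, p.2) : Pt d S)) := by
  obtain ⟨⟨ι, hι, p, hp⟩, hfin⟩ := h
  refine ⟨⟨ι, hι, fun i => ((p i).1 + y, (p i).2), ?_⟩, fun Δ hΔ => ?_⟩
  · rw [hp, Measure.map_sum (measurable_shift y).aemeasurable]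
    simp_rw [Measure.map_dirac' (measurable_shift y)]
  · obtain ⟨r, hr⟩ := hΔ.subset_closedBall (0 : Loc d)
    have hb := hfin (Metric.closedBall (-y) r) Metric.isBounded_closedBall
    refine lt_of_le_of_lt (measure_mono (t := Metric.closedBall 0 r ×ˢ univ) ?_) ?_
    · exact Set.prod_mono hr subset_rfl
    · rw [Measure.map_apply (measurable_shift y)
        (Metric.isClosed_closedBall.measurableSet.prod MeasurableSet.univ)]
      refine lt_of_le_of_lt (measure_mono ?_) hb
      rintro ⟨x, m⟩ hx
      simpa [dist_eq_norm] using hx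

/-- `θ_y γ`, the image of `γ` under the translation of locations by `y`. -/
def Config.translate (y : Loc d) (γ : Config d S) : Config d S :=
  ⟨γ.toMeasure.map fun p : Pt d S => ((p.1 + y, p.2) : Pt d S),
    isPointMeasure_map_shift γ.isPointMeasure y⟩

/-- `θ_y` on finite configurations. -/
def FinConfig.translate (y : Loc d) (γ : FinConfig d S) : FinConfig d S :=
  ⟨γ.toConfig.translate y, by
    change (γ.1.1.map fun p : Pt d S => ((p.1 + y, p.2) : Pt d S)) univ < ∞
    rw [Measure.map_apply (measurable_shift y) MeasurableSet.univ]
    exact γ.2⟩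

/-- The finite configuration `∑ i, δ_{p i}`. -/
def Config.ofPoints {k : ℕ} (p : Fin k → Pt d S) : Config d S :=
  ⟨Measure.sum fun i => Measure.dirac (p i), ⟨Fin k, inferInstance, p, rfl⟩, fun Λ _ => by
    refine lt_of_le_of_lt (measure_mono (subset_univ _)) ?_
    rw [Measure.sum_apply _ MeasurableSet.univ]
    simp⟩

variable (d S) in
/-- The empty configuration. -/
def FinConfig.empty : FinConfig d S :=
  ⟨⟨0, ⟨Empty, inferInstance, fun e => e.elim, by simp⟩, fun Λ _ => by simp⟩, by simp⟩

theorem isPointMeasure_glue [MeasurableSingletonClass S] (n : ℕ)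
    (ω : (Fin d → ℤ) → Config d S) :
    IsPointMeasure (Measure.sum fun κ : Fin d → ℤ =>
      (((ω κ).restrict (cube d n)).translate ((2 * n : ℝ) • latticePt κ)).toMeasure) := by
  set γ : (Fin d → ℤ) → Config d S := fun κ =>
    ((ω κ).restrict (cube d n)).translate ((2 * n : ℝ) • latticePt κ) with hγ
  choose ι hι p hp using fun κ => (γ κ).2.1
  refine ⟨⟨_, (inferInstance : Countable (Σ κ, ι κ)), fun q => p q.1 q.2, ?_⟩, fun Δ hΔ => ?_⟩
  · ext s hs
    rw [Measure.sum_apply _ hs, Measure.sum_apply _ hs, ENNReal.tsum_sigma']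
    refine tsum_congr fun κ => ?_
    conv_lhs => rw [hp κ]
    rw [Measure.sum_apply _ hs]
  · obtain ⟨r, hr⟩ := hΔ.subset_closedBall (0 : Loc d)
    have hB : MeasurableSet (Metric.closedBall (0 : Loc d) r ×ˢ (univ : Set S)) :=
      Metric.isClosed_closedBall.measurableSet.prod MeasurableSet.univ
    refine lt_of_le_of_lt (measure_mono (Set.prod_mono hr subset_rfl)) ?_
    rw [Measure.sum_apply _ hB]
    let N : ℤ := ⌈r + n⌉
    let F : Finset (Fin d → ℤ) := Fintype.piFinset fun _ => Finset.Icc (-N) N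
    rw [tsum_eq_sum (s := F)]
    · exact ENNReal.sum_lt_top.2 fun κ _ => (γ κ).2.2 _ Metric.isBounded_closedBall
    · intro κ hκ
      change (((ω κ).1.restrict (cube d n ×ˢ univ)).map fun q : Pt d S =>
        ((q.1 + (2 * n : ℝ) • latticePt κ, q.2) : Pt d S)) _ = 0
      rw [Measure.map_apply (measurable_shift _) hB,
        Measure.restrict_apply (measurable_shift _ hB)]
      refine measure_mono_null (t := ∅) ?_ measure_empty
      rintro ⟨x, m⟩ ⟨hx, hxc⟩
      refine hκ (Fintype.mem_piFinset.2 fun i => ?_)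
      have h1 : ‖x + (2 * n : ℝ) • latticePt κ‖ ≤ r := by simpa using hx
      have h2 := hxc.1 i
      have h3 : |x i + 2 * n * (κ i : ℝ)| ≤ r := by
        have := (PiLp.norm_apply_le (x + (2 * n : ℝ) • latticePt κ) i).trans h1
        simpa [latticePt] using this
      have hn : (1 : ℝ) ≤ n := by
        have h4 : 0 < n := by
          rcases Nat.eq_zero_or_pos n with h | h
          · subst h
            have := h2.1
            have := h2.2
            simp at *
            linarith
          · exact h
        exact_mod_cast h4
      have h5 : |(κ i : ℝ)| ≤ r + n := by
        have h6 : |2 * n * (κ i : ℝ)| ≤ r + n := by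
          rw [abs_le] at h3 ⊢
          constructor <;> linarith [h2.1, h2.2, h3.1, h3.2]
        rw [abs_mul, abs_of_pos (by linarith : (0 : ℝ) < 2 * n)] at h6
        nlinarith [abs_nonneg (κ i : ℝ)]
      have h7 : |κ i| ≤ N := by
        have : ((|κ i| : ℤ) : ℝ) ≤ (N : ℝ) := by
          push_cast
          exact h5.trans (Int.le_ceil _)
        exact_mod_cast this
      exact Finset.mem_Icc.2 (abs_le.1 h7)

/-- The configuration whose restriction to the block `[-n, n)^d + 2nκ` is the translate by `2nκ` of
the restriction of `ω κ` to `[-n, n)^d`, for every `κ ∈ ℤ^d`. -/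
def Config.glue [MeasurableSingletonClass S] (n : ℕ) (ω : (Fin d → ℤ) → Config d S) :
    Config d S :=
  ⟨_, isPointMeasure_glue n ω⟩

/-- The law of the Poisson point process on `ℝ^d × S` with finite intensity measure `μ`:
`e^{-μ(univ)} ∑ₖ (1 / k!) μ^{⊗k} ∘ ((p₁, …, pₖ) ↦ δ_{p₁} + … + δ_{pₖ})⁻¹`. -/
def poissonProcess (μ : Measure (Pt d S)) : Measure (Config d S) :=
  ENNReal.ofReal (Real.exp (-μ.real univ)) •
    Measure.sum fun k : ℕ =>
      (k ! : ℝ≥0∞)⁻¹ • (Measure.pi fun _ : Fin k => μ).map Config.ofPoints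

/-- `π^z_Λ`: the Poisson point process with intensity `z dx_Λ ⊗ R(dm)`. -/
def poissonVolume (z : ℝ≥0) (R : Measure S) (Λ : Set (Loc d)) : Measure (Config d S) :=
  poissonProcess ((z • (volume : Measure (Loc d)).restrict Λ).prod R)

variable (d S) in
/-- An energy functional: a measurable, translation-invariant map `𝓜_f → ℝ ∪ {+∞}` that vanishes at
the empty configuration. -/
structure EnergyFunctional where
  /-- the value of the energy -/
  toFun : FinConfig d S → EReal
  ne_bot : ∀ γ, toFun γ ≠ ⊥
  measurable : Measurable toFun
  translate_eq : ∀ (y : Loc d) (γ : FinConfig d S), toFun (γ.translate y) = toFun γ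
  map_empty : toFun (FinConfig.empty d S) = 0

/-- Partition function `Z_Λ = ∫ e^{-H(γ_Λ)} π^z_Λ(dγ)` for bounded `Λ`. -/
def partitionFunction [MeasurableSingletonClass S] (H : EnergyFunctional d S) (z : ℝ≥0)
    (R : Measure S) (Λ : Set (Loc d)) (hΛ : Bornology.IsBounded Λ) : ℝ≥0∞ :=
  ∫⁻ γ, EReal.exp (-H.toFun (γ.restrictFin Λ hΛ)) ∂(poissonVolume z R Λ)

/-- Finite-volume Gibbs measure with free boundary condition,
`P_Λ(dγ) = Z_Λ⁻¹ e^{-H(γ_Λ)} π^z_Λ(dγ)`. -/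
def gibbs [MeasurableSingletonClass S] (H : EnergyFunctional d S) (z : ℝ≥0)
    (R : Measure S) (Λ : Set (Loc d)) (hΛ : Bornology.IsBounded Λ) : Measure (Config d S) :=
  (partitionFunction H z R Λ hΛ)⁻¹ •
    (poissonVolume z R Λ).withDensity fun γ => EReal.exp (-H.toFun (γ.restrictFin Λ hΛ))

/-- For a probability measure `P` on configurations in `[-n, n)^d`: the law under which the
configurations in the disjoint blocks `[-n, n)^d + 2nκ`, `κ ∈ ℤ^d`, are independent copies (up to
translation) of `P`. -/
def blockLaw [MeasurableSingletonClass S] (n : ℕ) (P : Measure (Config d S)) :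
    Measure (Config d S) :=
  (Measure.infinitePi fun _ : Fin d → ℤ => P).map (Config.glue n)

/-- `P̃_n`: independent copies of `P_n = P_{[-n, n)^d}` in the blocks `[-n, n)^d + 2nκ`. -/
def tildeP [MeasurableSingletonClass S] (H : EnergyFunctional d S) (z : ℝ≥0) (R : Measure S)
    (n : ℕ) : Measure (Config d S) :=
  blockLaw n (gibbs H z R (cube d n) (isBounded_cube d n))

/-- `P̄_n = (2n)^{-d} ∑_{κ ∈ [-n, n)^d ∩ ℤ^d} P̃_n ∘ θ_κ⁻¹`. -/
def barP [MeasurableSingletonClass S] (H : EnergyFunctional d S) (z : ℝ≥0) (R : Measure S)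
    (n : ℕ) : Measure (Config d S) :=
  ((2 * n : ℝ≥0∞) ^ d)⁻¹ •
    ∑ κ ∈ Fintype.piFinset fun _ : Fin d => Finset.Ico (-(n : ℤ)) (n : ℤ),
      (tildeP H z R n).map (Config.translate (latticePt κ))

end Config

section Tempered

variable {d : ℕ} {S : Type*} [NormedAddCommGroup S] [MeasurableSpace S]

/-- `⟨γ, 1 + ‖m‖^{d + δ}⟩`. -/
def Config.moment (δ : ℝ) (γ : Config d S) : ℝ≥0∞ :=
  ∫⁻ p, ENNReal.ofReal (1 + ‖p.2‖ ^ ((d : ℝ) + δ)) ∂γ.toMeasure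

/-- Super-exponential moment of the law of `‖m‖` under `R`. -/
def HasSuperExpMoment (d : ℕ) (δ : ℝ) (R : Measure S) : Prop :=
  ∫⁻ r, ENNReal.ofReal (Real.exp (r ^ ((d : ℝ) + 2 * δ))) ∂(R.map fun m : S => ‖m‖) < ∞

/-- Stability: `H(γ) ≥ -c ⟨γ, 1 + ‖m‖^{d + δ}⟩` on finite configurations, for some `c ≥ 0`. -/
def EnergyFunctional.IsStable (δ : ℝ) (H : EnergyFunctional d S) : Prop :=
  ∃ c : ℝ≥0, ∀ γ : FinConfig d S, -((c * γ.toConfig.moment δ : ℝ≥0∞) : EReal) ≤ H.toFun γ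

variable (d S) in
/-- `𝓜^t`: configurations with `⟨γ_{B(0,l)}, 1 + ‖m‖^{d + δ}⟩ ≤ t l^d` for all `l ≥ 1`. -/
def temperedLevel [MeasurableSingletonClass S] (δ : ℝ) (t : ℕ) : Set (Config d S) :=
  {γ | ∀ l : ℕ, 1 ≤ l → (γ.restrict (Metric.ball 0 l)).moment δ ≤ (t : ℝ≥0∞) * (l : ℝ≥0∞) ^ d}

variable (d S) in
/-- The tempered configurations. -/
def tempered [MeasurableSingletonClass S] (δ : ℝ) : Set (Config d S) :=
  ⋃ t : ℕ, temperedLevel d S δ t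

variable (d S) in
/-- The tempered configurations such that, for every integer `k ≥ 1` with `k ≥ l`, no grain
`B(x, ‖m‖)` with germ `x` outside `B(0, 2k + 1)` meets `B(0, k)`. -/
def underM [MeasurableSingletonClass S] (δ : ℝ) (l : ℕ) : Set (Config d S) :=
  {γ | γ ∈ tempered d S δ ∧ ∀ k : ℕ, 1 ≤ k → l ≤ k → ∀ (x : Loc d) (m : S),
    (x, m) ∈ γ → x ∉ Metric.ball (0 : Loc d) (2 * k + 1) →
      Metric.ball x ‖m‖ ∩ Metric.ball (0 : Loc d) k = ∅}

end Tempered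

end MarkedGibbs

end

noncomputable section

namespace MarkedGibbs

/-! ### Measurability on the configuration space. -/

section Measurability

variable {d : ℕ} {S : Type*} [MeasurableSpace S]

/-! If a grain `B(x, ‖m‖)` with `‖x‖ ≥ 2k + 1` meets `B(0, k)`, then `‖m‖ > ‖x‖ - k ≥ ‖x‖ / 2`. So a
configuration outside `underM l` is non-tempered or has a point in `largeGrains l`
(`compl_underM_subset`). These two events are treated separately.

Large grains: by Markov's inequality, it suffices to bound the expected number of such points under
`barP`. The averaging shifts and the block shifts in `2nℤ^d` combine into distinct vectors of `ℤ^d`,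
so this expectation is at most `(2n)^{-d}` times a one-block expectation of a sum over `ℤ^d`-shifts.
A mark `m` contributes nothing if `‖m‖ < l`, and otherwise at most `(4‖m‖ + 1)^d ≤ 5^d l^{-δ}
‖m‖^{d+δ}` shifts. It remains to see that the moment of one block is of the order of its volume.
Stability and the Poisson Laplace functional bound its exponential moment by `exp(z V K)`, where `V`
is the volume and `K` an exponential moment of the mark weight, after the void probability in the
numerator cancels against the lower bound for the partition function
(`lintegral_eexp_moment_gibbs_le`). Hence the mean is at most `z V K + 1`. Dividing by `V = (2n)^d`
gives a bound `C l^{-δ}`, uniform in `n`.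

Temperedness: the block moments are i.i.d. with an exponential moment, so almost surely their sums
over growing boxes are bounded simultaneously by a constant plus a multiple of the number of blocks
(`ae_exists_forall_sum_le`). This needs no uniformity in `n`, since it yields an event of
probability one for each `n`. -/

theorem measurableSet_cube (d n : ℕ) : MeasurableSet (cube d n) := by
  have : cube d n = ⋂ i : Fin d, {x : Loc d | -(n : ℝ) ≤ x i ∧ x i < n} := by
    ext x; simp [cube]
  rw [this]
  refine MeasurableSet.iInter fun i => ?_
  have hi : Measurable fun x : Loc d => x i := by fun_prop
  exact (measurableSet_le measurable_const hi).inter (measurableSet_lt hi measurable_const)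

theorem Config.measurable_apply_prod {Λ : Set (Loc d)} (hΛ : MeasurableSet Λ)
    (hb : Bornology.IsBounded Λ) {A : Set S} (hA : MeasurableSet A) :
    Measurable fun γ : Config d S => γ.toMeasure (Λ ×ˢ A) := by
  refine measurable_iff_comap_le.2 ?_
  exact le_iSup_of_le Λ (le_iSup_of_le ⟨hΛ, hb⟩ (le_iSup_of_le A (le_iSup_of_le hA le_rfl)))

/-- Counting maps on bounded rectangles detect measurability of maps into `Config`. -/
theorem Config.measurable_of_apply_prod {α : Type*} [MeasurableSpace α] {g : α → Config d S}
    (h : ∀ (Λ : Set (Loc d)) (A : Set S), MeasurableSet Λ → Bornology.IsBounded Λ →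
      MeasurableSet A → Measurable fun a => (g a).toMeasure (Λ ×ˢ A)) :
    Measurable g := by
  refine measurable_iff_comap_le.2 ?_
  simp only [instMeasurableSpaceConfig, MeasurableSpace.comap_iSup, MeasurableSpace.comap_comp]
  exact iSup_le fun Λ => iSup_le fun hΛ => iSup_le fun A => iSup_le fun hA =>
    measurable_iff_comap_le.1 (h Λ A hΛ.1 hΛ.2 hA)

/-- The `σ`-algebra on configurations only sees bounded rectangles. Restricted to a ball the
measures are finite, so the π-system of rectangles determines measurability; monotone exhaustion by
balls removes the restriction. All functionals `γ ↦ ∫ f dγ` with measurable `f ≥ 0` become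
measurable this way. -/
theorem Config.measurable_toMeasure :
    Measurable (Config.toMeasure : Config d S → Measure (Pt d S)) := by
  have hball : ∀ N : ℕ, MeasurableSet (Metric.ball (0 : Loc d) N) := fun N => measurableSet_ball
  have key : ∀ N : ℕ, Measurable fun γ : Config d S =>
      γ.toMeasure.restrict (Metric.ball (0 : Loc d) N ×ˢ univ) := by
    intro N
    have hfin : ∀ γ : Config d S,
        IsFiniteMeasure (γ.toMeasure.restrict (Metric.ball (0 : Loc d) N ×ˢ univ)) := fun γ =>
      ⟨by rw [Measure.restrict_apply_univ]; exact γ.2.2 _ Metric.isBounded_ball⟩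
    refine Measurable.measure_of_isPiSystem generateFrom_prod.symm isPiSystem_prod ?_ ?_
    · rintro _ ⟨Λ, hΛ, A, hA, rfl⟩
      replace hΛ : MeasurableSet Λ := hΛ
      replace hA : MeasurableSet A := hA
      simp_rw [Measure.restrict_apply (MeasurableSet.prod hΛ hA), Set.prod_inter_prod, inter_univ]
      exact Config.measurable_apply_prod (hΛ.inter (hball N))
        (Metric.isBounded_ball.subset inter_subset_right) hA
    · simp_rw [Measure.restrict_apply_univ]
      exact Config.measurable_apply_prod (hball N) Metric.isBounded_ball MeasurableSet.univ
  refine Measure.measurable_of_measurable_coe _ fun s hs => ?_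
  have hs' : ∀ γ : Config d S, γ.toMeasure s =
      ⨆ N : ℕ, γ.toMeasure.restrict (Metric.ball (0 : Loc d) N ×ˢ univ) s := by
    intro γ
    simp_rw [Measure.restrict_apply hs]
    rw [← Monotone.measure_iUnion]
    · rw [← inter_iUnion, ← iUnion_prod_const, Metric.iUnion_ball_nat, univ_prod_univ, inter_univ]
    · intro a b hab
      exact inter_subset_inter_right _
        (prod_mono (Metric.ball_subset_ball (by exact_mod_cast hab)) subset_rfl)
  simp_rw [hs']
  exact Measurable.iSup fun N => (Measure.measurable_coe hs).comp (key N)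

theorem Config.measurable_lintegral {f : Pt d S → ℝ≥0∞} (hf : Measurable f) :
    Measurable fun γ : Config d S => ∫⁻ p, f p ∂γ.toMeasure :=
  (Measure.measurable_lintegral hf).comp Config.measurable_toMeasure

theorem Config.measurable_apply {s : Set (Pt d S)} (hs : MeasurableSet s) :
    Measurable fun γ : Config d S => γ.toMeasure s :=
  (Measure.measurable_coe hs).comp Config.measurable_toMeasure

theorem Config.measurable_setLIntegral {f : Pt d S → ℝ≥0∞} (hf : Measurable f)
    {s : Set (Pt d S)} (hs : MeasurableSet s) :
    Measurable fun γ : Config d S => ∫⁻ p in s, f p ∂γ.toMeasure := by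
  simp_rw [← lintegral_indicator hs]
  exact Config.measurable_lintegral (hf.indicator hs)

theorem Config.measurable_translate (y : Loc d) :
    Measurable (Config.translate y : Config d S → Config d S) := by
  refine Config.measurable_of_apply_prod fun Λ A hΛ _ hA => ?_
  simp only [Config.translate, Measure.map_apply (measurable_shift y) (hΛ.prod hA)]
  exact Config.measurable_apply (measurable_shift y (hΛ.prod hA))

theorem Config.measurable_ofPoints {k : ℕ} :
    Measurable (Config.ofPoints : (Fin k → Pt d S) → Config d S) := by
  refine Config.measurable_of_apply_prod fun Λ A hΛ _ hA => ?_
  simp only [Config.ofPoints, Measure.sum_apply _ (hΛ.prod hA), tsum_fintype,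
    Measure.dirac_apply' _ (hΛ.prod hA)]
  exact Finset.measurable_fun_sum _ fun i _ =>
    (measurable_const.indicator (hΛ.prod hA)).comp (measurable_pi_apply i)

theorem Config.lintegral_translate (y : Loc d) (γ : Config d S) {f : Pt d S → ℝ≥0∞}
    (hf : Measurable f) :
    ∫⁻ p, f p ∂(γ.translate y).toMeasure = ∫⁻ p, f (p.1 + y, p.2) ∂γ.toMeasure :=
  lintegral_map hf (measurable_shift y)

theorem Config.lintegral_ofPoints {k : ℕ} (q : Fin k → Pt d S) {f : Pt d S → ℝ≥0∞}
    (hf : Measurable f) :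
    ∫⁻ p, f p ∂(Config.ofPoints q).toMeasure = ∑ i, f (q i) := by
  simp only [Config.ofPoints, lintegral_sum_measure, lintegral_dirac' _ hf, tsum_fintype]

/-- A point measure takes values in `ℕ ∪ {∞}` on measurable sets. -/
theorem Config.one_le_of_ne_zero (γ : Config d S) {s : Set (Pt d S)} (hs : MeasurableSet s)
    (h : γ.toMeasure s ≠ 0) : 1 ≤ γ.toMeasure s := by
  obtain ⟨ι, _, p, hp⟩ := γ.2.1
  rw [hp, Measure.sum_apply _ hs] at h ⊢
  obtain ⟨i, hi⟩ : ∃ i, Measure.dirac (p i) s ≠ 0 := by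
    by_contra! hcon
    exact h (ENNReal.tsum_eq_zero.2 hcon)
  refine le_trans ?_ (ENNReal.le_tsum i)
  rw [Measure.dirac_apply' _ hs] at hi ⊢
  by_cases hm : p i ∈ s <;> simp_all

variable [MeasurableSingletonClass S]

theorem Config.measurable_restrict {Λ : Set (Loc d)} (hΛ : MeasurableSet Λ) :
    Measurable fun γ : Config d S => γ.restrict Λ := by
  refine Config.measurable_of_apply_prod fun Δ A hΔ _ hA => ?_
  simp only [Config.restrict, Measure.restrict_apply (hΔ.prod hA)]
  exact Config.measurable_apply ((hΔ.prod hA).inter (hΛ.prod MeasurableSet.univ))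

theorem Config.measurable_restrictFin {Λ : Set (Loc d)} (hΛ : MeasurableSet Λ)
    (hb : Bornology.IsBounded Λ) :
    Measurable fun γ : Config d S => γ.restrictFin Λ hb :=
  measurable_comap_iff.2 (Config.measurable_restrict hΛ)

theorem Config.lintegral_glue (n : ℕ) (ω : (Fin d → ℤ) → Config d S) {f : Pt d S → ℝ≥0∞}
    (hf : Measurable f) :
    ∫⁻ p, f p ∂(Config.glue n ω).toMeasure =
      ∑' κ, ∫⁻ p in cube d n ×ˢ univ, f (p.1 + (2 * n : ℝ) • latticePt κ, p.2)
        ∂(ω κ).toMeasure := by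
  simp only [Config.glue, lintegral_sum_measure, Config.lintegral_translate _ _ hf]
  rfl

theorem Config.measurable_glue (n : ℕ) :
    Measurable (Config.glue n : ((Fin d → ℤ) → Config d S) → Config d S) := by
  refine Config.measurable_of_apply_prod fun Λ A hΛ _ hA => ?_
  have h : Measurable ((Λ ×ˢ A).indicator fun _ : Pt d S => (1 : ℝ≥0∞)) :=
    measurable_const.indicator (hΛ.prod hA)
  simp_rw [← lintegral_indicator_one (hΛ.prod hA)]
  change Measurable fun ω => ∫⁻ p, (Λ ×ˢ A).indicator (fun _ => 1) p ∂(Config.glue n ω).toMeasure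
  simp_rw [Config.lintegral_glue n _ h]
  refine Measurable.tsum fun κ => ?_
  exact (Config.measurable_setLIntegral (h.comp (measurable_shift _))
    ((measurableSet_cube d n).prod MeasurableSet.univ)).comp (measurable_pi_apply κ)

end Measurability

/-! ### Extended exponential and product integrals. -/

section Exponential

/-- The exponential on `[0, ∞]`, with `exp ∞ = ∞`. -/
def eexp (x : ℝ≥0∞) : ℝ≥0∞ := EReal.exp (x : EReal)

theorem eexp_zero : eexp 0 = 1 := by simp [eexp]

theorem eexp_top : eexp ∞ = ∞ := by simp [eexp]

theorem eexp_add (x y : ℝ≥0∞) : eexp (x + y) = eexp x * eexp y := by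
  simp [eexp, EReal.exp_add]

theorem eexp_sum {ι : Type*} (s : Finset ι) (f : ι → ℝ≥0∞) :
    eexp (∑ i ∈ s, f i) = ∏ i ∈ s, eexp (f i) := by
  classical
  induction s using Finset.induction_on with
  | empty => simp [eexp_zero]
  | insert a s ha ih => rw [Finset.sum_insert ha, Finset.prod_insert ha, eexp_add, ih]

theorem eexp_mono : Monotone eexp := fun _ _ h =>
  EReal.exp_monotone (EReal.coe_ennreal_le_coe_ennreal_iff.2 h)

theorem measurable_eexp : Measurable eexp := eexp_mono.measurable

theorem eexp_ofReal {x : ℝ} (hx : 0 ≤ x) :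
    eexp (ENNReal.ofReal x) = ENNReal.ofReal (Real.exp x) := by
  rw [eexp, EReal.coe_ennreal_ofReal, max_eq_left hx, EReal.exp_coe]

theorem eexp_coe (x : ℝ≥0) : eexp x = ENNReal.ofReal (Real.exp x) := by
  rw [← eexp_ofReal x.coe_nonneg, ENNReal.ofReal_coe_nnreal]

theorem one_le_eexp (x : ℝ≥0∞) : 1 ≤ eexp x := by
  rw [← eexp_zero]; exact eexp_mono bot_le

/-- `x ≤ a + e^{x - a}`. -/
theorem le_add_exp_mul_eexp (x : ℝ≥0∞) {a : ℝ} (ha : 0 ≤ a) :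
    x ≤ ENNReal.ofReal a + ENNReal.ofReal (Real.exp (-a)) * eexp x := by
  induction x using ENNReal.recTopCoe with
  | top => simp [eexp_top, ENNReal.mul_top, Real.exp_pos]
  | coe x =>
    rw [eexp_coe, ← ENNReal.ofReal_mul (Real.exp_pos _).le, ← Real.exp_add,
      ← ENNReal.ofReal_add ha (Real.exp_pos _).le, ← ENNReal.ofReal_coe_nnreal]
    refine ENNReal.ofReal_le_ofReal ?_
    linarith [Real.add_one_le_exp (-a + x)]

theorem eexp_le_eexp_iff {x y : ℝ≥0∞} : eexp x ≤ eexp y ↔ x ≤ y := by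
  simp [eexp]

theorem le_eexp (x : ℝ≥0∞) : x ≤ eexp x := by
  simpa using le_add_exp_mul_eexp x le_rfl

theorem eexp_natCast_mul (n : ℕ) (x : ℝ≥0∞) : eexp (n * x) = eexp x ^ n := by
  simpa using eexp_sum (Finset.range n) fun _ => x

theorem tsum_inv_factorial_mul_pow {A : ℝ≥0∞} (hA : A ≠ ∞) :
    ∑' k : ℕ, (k ! : ℝ≥0∞)⁻¹ * A ^ k = ENNReal.ofReal (Real.exp A.toReal) := by
  have h := NormedSpace.expSeries_div_hasSum_exp A.toReal
  rw [← Real.exp_eq_exp_ℝ] at h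
  rw [← h.tsum_eq, ENNReal.ofReal_tsum_of_nonneg (fun k => by positivity) h.summable]
  refine tsum_congr fun k => ?_
  rw [ENNReal.ofReal_div_of_pos (by positivity), ENNReal.ofReal_pow ENNReal.toReal_nonneg,
    ENNReal.ofReal_toReal hA, ENNReal.ofReal_natCast, ENNReal.div_eq_inv_mul]

theorem lintegral_pi_prod {α : Type*} [MeasurableSpace α] (μ : Measure α) [IsFiniteMeasure μ]
    {h : α → ℝ≥0∞} (hh : Measurable h) (k : ℕ) :
    ∫⁻ q : Fin k → α, ∏ i, h (q i) ∂(Measure.pi fun _ => μ) = (∫⁻ a, h a ∂μ) ^ k := by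
  induction k with
  | zero => simp
  | succ k ih =>
    have hm := (measurePreserving_piFinSuccAbove (fun _ : Fin (k + 1) => μ) 0).symm
    rw [← hm.lintegral_comp (by fun_prop)]
    simp only [Fin.prod_univ_succ]
    have h2 : Measurable fun q : Fin k → α => ∏ i, h (q i) := by fun_prop
    have := lintegral_prod_mul (μ := μ) (ν := Measure.pi fun _ : Fin k => μ)
      hh.aemeasurable h2.aemeasurable
    rw [pow_succ', ← ih, ← this]
    rfl

end Exponential

/-! ### Poisson exponential moments and void probability. -/

section Poisson

variable {d : ℕ} {S : Type*} [MeasurableSpace S]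

/-- The Laplace functional of a Poisson process, at positive exponents. -/
theorem lintegral_eexp_poissonProcess (μ : Measure (Pt d S)) [IsFiniteMeasure μ]
    {g : Pt d S → ℝ≥0∞} (hg : Measurable g) (hA : ∫⁻ p, eexp (g p) ∂μ ≠ ∞) :
    ∫⁻ γ, eexp (∫⁻ p, g p ∂γ.toMeasure) ∂(poissonProcess μ) =
      ENNReal.ofReal (Real.exp (-μ.real univ)) *
        ENNReal.ofReal (Real.exp (∫⁻ p, eexp (g p) ∂μ).toReal) := by
  have hm : Measurable fun γ : Config d S => eexp (∫⁻ p, g p ∂γ.toMeasure) :=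
    measurable_eexp.comp (Config.measurable_lintegral hg)
  rw [poissonProcess, lintegral_smul_measure, lintegral_sum_measure, smul_eq_mul,
    ← tsum_inv_factorial_mul_pow hA]
  congr 1
  refine tsum_congr fun k => ?_
  rw [lintegral_smul_measure, lintegral_map hm Config.measurable_ofPoints, smul_eq_mul,
    ← lintegral_pi_prod μ (h := fun p => eexp (g p)) (measurable_eexp.comp hg) k]
  simp_rw [Config.lintegral_ofPoints _ hg, eexp_sum]

/-- Keep only the zero-point term of the Poisson series. -/
theorem exp_neg_le_lintegral_poissonProcess (μ : Measure (Pt d S))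
    (F : Config d S → ℝ≥0∞) (hF : Measurable F)
    (h1 : ∀ q : Fin 0 → Pt d S, F (Config.ofPoints q) = 1) :
    ENNReal.ofReal (Real.exp (-μ.real univ)) ≤ ∫⁻ γ, F γ ∂(poissonProcess μ) := by
  rw [poissonProcess, lintegral_smul_measure, lintegral_sum_measure, smul_eq_mul]
  refine le_mul_of_one_le_right' ?_
  refine le_trans ?_ (ENNReal.le_tsum 0)
  rw [lintegral_smul_measure, lintegral_map hF Config.measurable_ofPoints]
  simp [h1]

theorem volume_cube (d n : ℕ) :
    (volume : Measure (Loc d)) (cube d n) = ENNReal.ofReal ((2 * n : ℝ) ^ d) := by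
  have h : cube d n = (WithLp.ofLp : Loc d → Fin d → ℝ) ⁻¹'
      (univ.pi fun _ => Ico (-(n : ℝ)) n) := by
    ext x; simp [cube, Set.mem_pi]
  rw [h, (PiLp.volume_preserving_ofLp (Fin d)).measure_preimage
    (MeasurableSet.univ_pi fun _ => measurableSet_Ico).nullMeasurableSet, volume_pi_pi]
  simp [Real.volume_Ico, ← ENNReal.ofReal_pow, two_mul]

end Poisson

/-! ### Exponential and first moments of the finite-volume Gibbs measures. -/

section GibbsMoments

variable {d : ℕ} {S : Type*} [NormedAddCommGroup S] [MeasurableSpace S]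

/-- The weight `1 + ‖m‖^{d + δ}` of a mark. -/
def markWeight (d : ℕ) (δ : ℝ) (m : S) : ℝ≥0∞ := ENNReal.ofReal (1 + ‖m‖ ^ ((d : ℝ) + δ))

theorem Config.moment_eq (δ : ℝ) (γ : Config d S) :
    γ.moment δ = ∫⁻ p, markWeight d δ p.2 ∂γ.toMeasure := rfl

/-- Beyond the threshold `r = C^{1/(b-a)}` one has `C r^a ≤ r^b`; below it, `r^a` is bounded. -/
theorem exists_mul_one_add_rpow_le {a b C : ℝ} (ha : 0 < a) (hab : a < b) (hC : 0 ≤ C) :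
    ∃ D : ℝ, ∀ r : ℝ, 0 ≤ r → C * (1 + r ^ a) ≤ D + r ^ b := by
  refine ⟨C + C * (C ^ (b - a)⁻¹) ^ a, fun r hr => ?_⟩
  have hba : 0 < b - a := sub_pos.2 hab
  have hra : 0 ≤ r ^ a := Real.rpow_nonneg hr a
  have hrb : 0 ≤ r ^ b := Real.rpow_nonneg hr b
  have hC' : 0 ≤ C ^ (b - a)⁻¹ := Real.rpow_nonneg hC _
  rcases le_total r (C ^ (b - a)⁻¹) with h | h
  · have := mul_le_mul_of_nonneg_left (Real.rpow_le_rpow hr h ha.le) hC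
    linarith
  · have h1 : C ≤ r ^ (b - a) := by
      have := Real.rpow_le_rpow hC' h hba.le
      rwa [← Real.rpow_mul hC, inv_mul_cancel₀ hba.ne', Real.rpow_one] at this
    have h2 : r ^ b = r ^ (b - a) * r ^ a := by
      rw [← Real.rpow_add_of_nonneg hr hba.le ha.le, sub_add_cancel]
    have := mul_le_mul_of_nonneg_right h1 hra
    have := mul_nonneg hC (Real.rpow_nonneg hC' a)
    linarith

variable [BorelSpace S]

theorem measurable_markWeight (δ : ℝ) : Measurable (markWeight d δ : S → ℝ≥0∞) :=
  ((measurable_const.add (measurable_norm.pow_const _))).ennreal_ofReal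

/-- A super-exponential moment of order `d + 2δ` controls all exponential moments of
`1 + ‖m‖^{d + δ}`. -/
theorem lintegral_eexp_markWeight_ne_top (hd : 1 ≤ d) {R : Measure S} {δ : ℝ}
    (hδ : 0 < δ) (hR : HasSuperExpMoment d δ R) (C : ℝ≥0) :
    ∫⁻ m, eexp (C * markWeight d δ m) ∂ R ≠ ∞ := by
  have hd' : (1 : ℝ) ≤ d := by exact_mod_cast hd
  obtain ⟨D, hD⟩ := exists_mul_one_add_rpow_le (a := d + δ) (b := d + 2 * δ) (C := C)
    (by linarith) (by linarith) C.coe_nonneg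
  rw [HasSuperExpMoment, lintegral_map (by fun_prop) measurable_norm] at hR
  refine ne_top_of_le_ne_top (ENNReal.mul_ne_top ENNReal.ofReal_ne_top hR.ne)
    (b := ENNReal.ofReal (Real.exp D) * _) ?_
  rw [← lintegral_const_mul _ (by fun_prop)]
  refine lintegral_mono fun m => ?_
  rw [markWeight, ← ENNReal.ofReal_coe_nnreal, ← ENNReal.ofReal_mul C.coe_nonneg,
    eexp_ofReal (by positivity), ← ENNReal.ofReal_mul (Real.exp_pos _).le, ← Real.exp_add]
  exact ENNReal.ofReal_le_ofReal (Real.exp_le_exp.2 (hD _ (norm_nonneg m)))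

variable (H : EnergyFunctional d S) (z : ℝ≥0) (R : Measure S)

theorem measurable_boltzmann {Λ : Set (Loc d)} (hΛ : MeasurableSet Λ)
    (hb : Bornology.IsBounded Λ) :
    Measurable fun γ : Config d S => EReal.exp (-H.toFun (γ.restrictFin Λ hb)) :=
  EReal.exp_monotone.measurable.comp
    ((H.measurable.comp (Config.measurable_restrictFin hΛ hb)).neg)

theorem lintegral_gibbs {Λ : Set (Loc d)} (hΛ : MeasurableSet Λ)
    (hb : Bornology.IsBounded Λ) {F : Config d S → ℝ≥0∞} (hF : Measurable F) :
    ∫⁻ γ, F γ ∂(gibbs H z R Λ hb) = (partitionFunction H z R Λ hb)⁻¹ *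
      ∫⁻ γ, EReal.exp (-H.toFun (γ.restrictFin Λ hb)) * F γ ∂(poissonVolume z R Λ) := by
  rw [gibbs, lintegral_smul_measure,
    lintegral_withDensity_eq_lintegral_mul _ (measurable_boltzmann H hΛ hb) hF]
  rfl



theorem exp_neg_le_partitionFunction {Λ : Set (Loc d)} (hΛ : MeasurableSet Λ)
    (hb : Bornology.IsBounded Λ) :
    ENNReal.ofReal (Real.exp (-((z • (volume : Measure (Loc d)).restrict Λ).prod R).real univ)) ≤
      partitionFunction H z R Λ hb := by
  refine exp_neg_le_lintegral_poissonProcess _ _ (measurable_boltzmann H hΛ hb) fun q => ?_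
  have : (Config.ofPoints q).restrictFin Λ hb = FinConfig.empty d S := by
    simp [Config.restrictFin, Config.restrict, Config.ofPoints, FinConfig.empty]
  rw [this, H.map_empty]
  simp

theorem partitionFunction_ne_zero {Λ : Set (Loc d)} (hΛ : MeasurableSet Λ)
    (hb : Bornology.IsBounded Λ) : partitionFunction H z R Λ hb ≠ 0 :=
  ((ENNReal.ofReal_pos.2 (Real.exp_pos _)).trans_le
    (exp_neg_le_partitionFunction H z R hΛ hb)).ne'

variable [IsProbabilityMeasure R] {H} {δ : ℝ} {c : ℝ≥0}

/-- Stability turns the Boltzmann factor into `exp(c · moment)`, so together with `exp(moment)` the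
integrand is an exponential with factor `1 + c`, which the Laplace functional evaluates. The void
probability is kept explicit so that it cancels against the lower bound on the partition function.
-/
theorem lintegral_boltzmann_mul_eexp_le
    (hc : ∀ γ : FinConfig d S, -((c * γ.toConfig.moment δ : ℝ≥0∞) : EReal) ≤ H.toFun γ)
    {K : ℝ≥0} (hK : ∫⁻ m, eexp ((1 + c : ℝ≥0) * markWeight d δ m) ∂ R = K)
    {Λ : Set (Loc d)} (hb : Bornology.IsBounded Λ) {V : ℝ≥0}
    (hV : (volume : Measure (Loc d)) Λ = V) :
    ∫⁻ γ, EReal.exp (-H.toFun (γ.restrictFin Λ hb)) * eexp ((γ.restrict Λ).moment δ)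
        ∂(poissonVolume z R Λ) ≤
      ENNReal.ofReal (Real.exp (-((z • (volume : Measure (Loc d)).restrict Λ).prod R).real univ)) *
        ENNReal.ofReal (Real.exp (z * V * K)) := by
  set μ := (z • (volume : Measure (Loc d)).restrict Λ).prod R with hμ
  have hfin : IsFiniteMeasure ((volume : Measure (Loc d)).restrict Λ) :=
    ⟨by rw [Measure.restrict_apply_univ, hV]; exact ENNReal.coe_lt_top⟩
  have hg : Measurable fun p : Pt d S => ((1 + c : ℝ≥0) : ℝ≥0∞) * markWeight d δ p.2 :=
    ((measurable_markWeight δ).comp measurable_snd).const_mul _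
  have hA : ∫⁻ p, eexp ((1 + c : ℝ≥0) * markWeight d δ p.2) ∂μ = (z * V * K : ℝ≥0) := by
    rw [← lintegral_map (μ := μ) (g := Prod.snd)
      (f := fun m => eexp ((1 + c : ℝ≥0) * markWeight d δ m))
      (measurable_eexp.comp ((measurable_markWeight δ).const_mul _)) measurable_snd, hμ,
      Measure.map_snd_prod, lintegral_smul_measure, hK]
    rw [Measure.smul_apply, Measure.restrict_apply_univ, hV, ENNReal.smul_def, smul_eq_mul]
    push_cast
    rfl
  have h := lintegral_eexp_poissonProcess μ hg (by rw [hA]; exact ENNReal.coe_ne_top)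
  rw [hA] at h
  push_cast at h
  simp only [ENNReal.toReal_mul, ENNReal.coe_toReal] at h
  rw [← h]
  refine lintegral_mono fun γ => ?_
  -- An inequality suffices, which avoids proving that the Poisson process charges only
  -- configurations inside `Λ`.
  have hmom : (γ.restrict Λ).moment δ ≤ ∫⁻ p, markWeight d δ p.2 ∂γ.toMeasure :=
    lintegral_mono' Measure.restrict_le_self le_rfl
  have h1 : EReal.exp (-H.toFun (γ.restrictFin Λ hb)) ≤ eexp (c * (γ.restrict Λ).moment δ) :=
    EReal.exp_monotone (EReal.neg_le_of_neg_le (hc (γ.restrictFin Λ hb)))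
  calc _ ≤ eexp (c * (γ.restrict Λ).moment δ) * eexp ((γ.restrict Λ).moment δ) :=
        mul_le_mul_left h1 _
    _ = eexp ((1 + c) * (γ.restrict Λ).moment δ) := by rw [← eexp_add, add_mul, one_mul, add_comm]
    _ ≤ _ := by
      have hm : Measurable fun p : Pt d S => markWeight d δ p.2 :=
        (measurable_markWeight δ).comp measurable_snd
      rw [lintegral_const_mul _ hm]
      exact eexp_mono (mul_le_mul_right hmom _)

theorem isProbabilityMeasure_gibbs
    (hc : ∀ γ : FinConfig d S, -((c * γ.toConfig.moment δ : ℝ≥0∞) : EReal) ≤ H.toFun γ)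
    {K : ℝ≥0} (hK : ∫⁻ m, eexp ((1 + c : ℝ≥0) * markWeight d δ m) ∂ R = K)
    {Λ : Set (Loc d)} (hΛ : MeasurableSet Λ) (hb : Bornology.IsBounded Λ) {V : ℝ≥0}
    (hV : (volume : Measure (Loc d)) Λ = V) :
    IsProbabilityMeasure (gibbs H z R Λ hb) := by
  refine ⟨?_⟩
  rw [← lintegral_one, lintegral_gibbs H z R hΛ hb measurable_const]
  simp_rw [mul_one]
  refine ENNReal.inv_mul_cancel (partitionFunction_ne_zero H z R hΛ hb) (ne_top_of_le_ne_top
    (ENNReal.mul_ne_top ENNReal.ofReal_ne_top ENNReal.ofReal_ne_top)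
    ((lintegral_mono fun γ => ?_).trans (lintegral_boltzmann_mul_eexp_le z R hc hK hb hV)))
  exact le_mul_of_one_le_right' (one_le_eexp _)

theorem lintegral_eexp_moment_gibbs_le
    (hc : ∀ γ : FinConfig d S, -((c * γ.toConfig.moment δ : ℝ≥0∞) : EReal) ≤ H.toFun γ)
    {K : ℝ≥0} (hK : ∫⁻ m, eexp ((1 + c : ℝ≥0) * markWeight d δ m) ∂ R = K)
    {Λ : Set (Loc d)} (hΛ : MeasurableSet Λ) (hb : Bornology.IsBounded Λ) {V : ℝ≥0}
    (hV : (volume : Measure (Loc d)) Λ = V) :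
    ∫⁻ γ, eexp ((γ.restrict Λ).moment δ) ∂(gibbs H z R Λ hb) ≤
      ENNReal.ofReal (Real.exp (z * V * K)) := by
  have hm : Measurable fun p : Pt d S => markWeight d δ p.2 :=
    (measurable_markWeight δ).comp measurable_snd
  rw [lintegral_gibbs H z R hΛ hb (F := fun γ => eexp ((γ.restrict Λ).moment δ))
    (measurable_eexp.comp (Config.measurable_setLIntegral hm (hΛ.prod MeasurableSet.univ)))]
  have h0 : ENNReal.ofReal (Real.exp
      (-((z • (volume : Measure (Loc d)).restrict Λ).prod R).real univ)) ≠ 0 :=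
    (ENNReal.ofReal_pos.2 (Real.exp_pos _)).ne'
  refine (mul_le_mul' (ENNReal.inv_le_inv.2 (exp_neg_le_partitionFunction H z R hΛ hb))
    (lintegral_boltzmann_mul_eexp_le z R hc hK hb hV)).trans_eq ?_
  rw [← mul_assoc, ENNReal.inv_mul_cancel h0 ENNReal.ofReal_ne_top, one_mul]

/-- A substitute for Jensen's inequality: integrate `x ≤ a + e^{x-a}` with `a = z V K`, the exponent
in the exponential moment bound. The second term then contributes at most `1`. -/
theorem lintegral_moment_gibbs_le
    (hc : ∀ γ : FinConfig d S, -((c * γ.toConfig.moment δ : ℝ≥0∞) : EReal) ≤ H.toFun γ)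
    {K : ℝ≥0} (hK : ∫⁻ m, eexp ((1 + c : ℝ≥0) * markWeight d δ m) ∂ R = K)
    {Λ : Set (Loc d)} (hΛ : MeasurableSet Λ) (hb : Bornology.IsBounded Λ) {V : ℝ≥0}
    (hV : (volume : Measure (Loc d)) Λ = V) :
    ∫⁻ γ, (γ.restrict Λ).moment δ ∂(gibbs H z R Λ hb) ≤ z * V * K + 1 := by
  have hp := isProbabilityMeasure_gibbs z R hc hK hΛ hb hV
  have hm : Measurable fun p : Pt d S => markWeight d δ p.2 :=
    (measurable_markWeight δ).comp measurable_snd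
  have hX : Measurable fun γ : Config d S => eexp ((γ.restrict Λ).moment δ) :=
    measurable_eexp.comp (Config.measurable_setLIntegral hm (hΛ.prod MeasurableSet.univ))
  refine (lintegral_mono fun γ => le_add_exp_mul_eexp _
    (show (0 : ℝ) ≤ z * V * K by positivity)).trans ?_
  rw [lintegral_add_left measurable_const, lintegral_const_mul _ hX, lintegral_const,
    measure_univ, mul_one]
  refine add_le_add (le_of_eq ?_) ?_
  · rw [← NNReal.coe_mul, ← NNReal.coe_mul, ENNReal.ofReal_coe_nnreal]
    push_cast
    rfl
  · refine (mul_le_mul_right (lintegral_eexp_moment_gibbs_le z R hc hK hΛ hb hV) _).trans_eq ?_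
    rw [← ENNReal.ofReal_mul (Real.exp_pos _).le, ← Real.exp_add]
    simp

end GibbsMoments

/-! ### Intensity of the block law and its average over translations. -/

section Intensity

variable {d : ℕ} {S : Type*} [MeasurableSpace S] [MeasurableSingletonClass S]

theorem isProbabilityMeasure_blockLaw (n : ℕ) (P : Measure (Config d S))
    [IsProbabilityMeasure P] : IsProbabilityMeasure (blockLaw n P) :=
  Measure.isProbabilityMeasure_map (Config.measurable_glue n).aemeasurable

/-- Expectations of additive functionals involve only the one-block marginals; independence plays no
role. -/
theorem lintegral_lintegral_blockLaw (n : ℕ) (P : Measure (Config d S))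
    [IsProbabilityMeasure P] {g : Pt d S → ℝ≥0∞} (hg : Measurable g) :
    ∫⁻ γ, ∫⁻ p, g p ∂γ.toMeasure ∂(blockLaw n P) =
      ∑' κ : Fin d → ℤ, ∫⁻ γ, ∫⁻ p in cube d n ×ˢ univ,
        g (p.1 + (2 * n : ℝ) • latticePt κ, p.2) ∂γ.toMeasure ∂P := by
  have hm : ∀ κ : Fin d → ℤ, Measurable fun γ : Config d S => ∫⁻ p in cube d n ×ˢ univ,
      g (p.1 + (2 * n : ℝ) • latticePt κ, p.2) ∂γ.toMeasure := fun κ =>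
    Config.measurable_setLIntegral (hg.comp (measurable_shift _))
      ((measurableSet_cube d n).prod MeasurableSet.univ)
  rw [blockLaw, lintegral_map (Config.measurable_lintegral hg) (Config.measurable_glue n)]
  simp_rw [Config.lintegral_glue n _ hg]
  refine (lintegral_tsum fun κ => ((hm κ).comp (measurable_pi_apply κ)).aemeasurable).trans ?_
  exact tsum_congr fun κ =>
    (measurePreserving_eval_infinitePi (fun _ : Fin d → ℤ => P) κ).lintegral_comp (hm κ)

/-- Sites of the period cell together with translations by `2n ℤ^d` cover `ℤ^d` at most once. -/
theorem sum_tsum_latticePt_le {n : ℕ} (G : Loc d → ℝ≥0∞) :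
    ∑ κ ∈ Fintype.piFinset fun _ : Fin d => Finset.Ico (-(n : ℤ)) (n : ℤ),
      ∑' κ' : Fin d → ℤ, G ((2 * n : ℝ) • latticePt κ' + latticePt κ) ≤
      ∑' i : Fin d → ℤ, G (latticePt i) := by
  set B := Fintype.piFinset fun _ : Fin d => Finset.Ico (-(n : ℤ)) (n : ℤ) with hB
  rw [← Finset.tsum_subtype B fun κ => ∑' κ' : Fin d → ℤ,
    G ((2 * n : ℝ) • latticePt κ' + latticePt κ)]
  rw [← ENNReal.tsum_prod (f := fun (κ : B) (κ' : Fin d → ℤ) =>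
    G ((2 * n : ℝ) • latticePt κ' + latticePt (κ : Fin d → ℤ)))]
  let site : B × (Fin d → ℤ) → Fin d → ℤ := fun q i => 2 * n * q.2 i + q.1.1 i
  have hsite : Function.Injective site := by
    rintro ⟨⟨a, ha⟩, a'⟩ ⟨⟨b, hb⟩, b'⟩ h
    have key : ∀ i, a i = b i ∧ a' i = b' i := by
      intro i
      have h1 : 2 * n * a' i + a i = 2 * n * b' i + b i := congrFun h i
      have ha1 := Finset.mem_Ico.1 (Fintype.mem_piFinset.1 ha i)
      have hb1 := Finset.mem_Ico.1 (Fintype.mem_piFinset.1 hb i)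
      -- Uniqueness of the residue modulo `2n` in `[-n, n)`.
      have h2 : a i - b i = 0 := Int.eq_zero_of_abs_lt_dvd (m := 2 * n)
        ⟨b' i - a' i, by linear_combination h1⟩ (abs_lt.2 ⟨by linarith, by linarith⟩)
      have hn : (2 * n : ℤ) ≠ 0 := by omega
      exact ⟨by linarith, mul_left_cancel₀ hn (by linarith)⟩
    have h1 : a = b := funext fun i => (key i).1
    have h2 : a' = b' := funext fun i => (key i).2
    subst h1 h2
    rfl
  refine le_trans (le_of_eq (tsum_congr fun q => ?_))
    (ENNReal.tsum_comp_le_tsum_of_injective hsite fun i => G (latticePt i))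
  congr 1
  ext i
  simp [latticePt, site]

/-- Intensity of the averaged block law: it is dominated by the `ℤ^d`-periodization of the
intensity of a single block. -/
theorem sum_lintegral_translate_blockLaw_le {n : ℕ} (P : Measure (Config d S))
    [IsProbabilityMeasure P] {g : Pt d S → ℝ≥0∞} (hg : Measurable g) :
    ∑ κ ∈ Fintype.piFinset fun _ : Fin d => Finset.Ico (-(n : ℤ)) (n : ℤ),
      ∫⁻ γ, ∫⁻ p, g p ∂γ.toMeasure ∂((blockLaw n P).map (Config.translate (latticePt κ))) ≤
      ∫⁻ γ, ∫⁻ p in cube d n ×ˢ univ, ∑' i : Fin d → ℤ, g (p.1 + latticePt i, p.2)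
        ∂γ.toMeasure ∂P := by
  have hg' : ∀ y : Loc d, Measurable fun p : Pt d S => g (p.1 + y, p.2) := fun y =>
    hg.comp (measurable_shift y)
  let G : Loc d → ℝ≥0∞ := fun y =>
    ∫⁻ γ, ∫⁻ p in cube d n ×ˢ univ, g (p.1 + y, p.2) ∂γ.toMeasure ∂P
  have hR : ∫⁻ γ, ∫⁻ p in cube d n ×ˢ univ, ∑' i : Fin d → ℤ, g (p.1 + latticePt i, p.2)
      ∂γ.toMeasure ∂P = ∑' i : Fin d → ℤ, G (latticePt i) := by
    simp_rw [lintegral_tsum fun i : Fin d → ℤ => (hg' (latticePt i)).aemeasurable]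
    exact lintegral_tsum fun i => (Config.measurable_setLIntegral (hg' _)
      ((measurableSet_cube d n).prod MeasurableSet.univ)).aemeasurable
  rw [hR]
  refine le_trans (le_of_eq (Finset.sum_congr rfl fun κ _ => ?_)) (sum_tsum_latticePt_le G)
  rw [lintegral_map (Config.measurable_lintegral hg) (Config.measurable_translate _)]
  simp_rw [Config.lintegral_translate _ _ hg]
  rw [lintegral_lintegral_blockLaw n P (hg' _)]
  simp_rw [add_assoc]
  rfl

end Intensity

/-! ### Counting grains that reach far towards the origin. -/

section LargeGrains

variable {d : ℕ} {S : Type*} [NormedAddCommGroup S]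

variable (d S) in
/-- Marked points outside `B(0, 2l + 1)` whose mark has norm at least half that of the location. -/
def largeGrains (l : ℕ) : Set (Pt d S) := {p | 2 * (l : ℝ) + 1 ≤ ‖p.1‖ ∧ ‖p.1‖ ≤ 2 * ‖p.2‖}

theorem measurableSet_largeGrains [MeasurableSpace S] [BorelSpace S] (l : ℕ) :
    MeasurableSet (largeGrains d S l) := by
  have h1 : Measurable fun p : Pt d S => ‖p.1‖ := measurable_norm.comp measurable_fst
  have h2 : Measurable fun p : Pt d S => ‖p.2‖ := measurable_norm.comp measurable_snd
  exact (measurableSet_le measurable_const h1).inter (measurableSet_le h1 (h2.const_mul 2))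

/-- Each coordinate of `i` lies in an interval of length `2r`, which contains at most `2r + 1`
integers. -/
theorem tsum_indicator_norm_le (x : Loc d) {r : ℝ} (hr : 0 ≤ r) :
    ∑' i : Fin d → ℤ, {i : Fin d → ℤ | ‖x + latticePt i‖ ≤ r}.indicator (fun _ => (1 : ℝ≥0∞)) i ≤
      ENNReal.ofReal ((2 * r + 1) ^ d) := by
  let F : Finset (Fin d → ℤ) := Fintype.piFinset fun j => Finset.Icc ⌈-x j - r⌉ ⌊-x j + r⌋
  rw [tsum_eq_sum (s := F)]
  · refine (Finset.sum_le_sum fun i _ => indicator_le_self' (fun _ _ => zero_le_one) i).trans ?_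
    rw [Finset.sum_const, nsmul_one, Fintype.card_piFinset, ← ENNReal.ofReal_natCast]
    refine ENNReal.ofReal_le_ofReal ?_
    push_cast
    refine (Finset.prod_le_prod (fun _ _ => by positivity) fun j _ => ?_).trans_eq
      (by rw [Finset.prod_const, Finset.card_univ, Fintype.card_fin])
    rw [Int.card_Icc]
    have h1 : (((⌊-x j + r⌋ + 1 - ⌈-x j - r⌉).toNat : ℤ) : ℝ) ≤ 2 * r + 1 := by
      rw [Int.toNat_eq_max]
      push_cast
      refine max_le ?_ (by positivity)
      linarith [Int.floor_le (-x j + r), Int.le_ceil (-x j - r)]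
    exact_mod_cast h1
  · intro i hi
    refine indicator_of_notMem (fun h => hi (Fintype.mem_piFinset.2 fun j => ?_)) _
    have h1 := (PiLp.norm_apply_le (x + latticePt i) j).trans h
    have h2 : |x j + i j| ≤ r := by simpa [latticePt] using h1
    rw [abs_le] at h2
    exact Finset.mem_Icc.2 ⟨Int.ceil_le.2 (by linarith), Int.le_floor.2 (by linarith)⟩

/-- Only marks with `‖m‖ ≥ l` contribute. For these, the lattice count is of order `‖m‖^d`, and the
spare power `‖m‖^δ ≥ l^δ` in the weight yields the decay in `l`. -/
theorem tsum_indicator_largeGrains_le {l : ℕ} (hl : 1 ≤ l) {δ : ℝ} (hδ : 0 < δ)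
    (x : Loc d) (m : S) :
    ∑' i : Fin d → ℤ, (largeGrains d S l).indicator (fun _ => (1 : ℝ≥0∞)) (x + latticePt i, m) ≤
      ENNReal.ofReal (5 ^ d * (l : ℝ) ^ (-δ)) * markWeight d δ m := by
  have hl' : (1 : ℝ) ≤ l := by exact_mod_cast hl
  rcases lt_or_ge ‖m‖ l with hm | hm
  · refine le_of_eq_of_le (ENNReal.tsum_eq_zero.2 fun i => ?_) bot_le
    refine indicator_of_notMem (fun h => ?_) _
    have h1 : 2 * (l : ℝ) + 1 ≤ ‖x + latticePt i‖ := h.1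
    have h2 : ‖x + latticePt i‖ ≤ 2 * ‖m‖ := h.2
    linarith
  · refine (ENNReal.tsum_le_tsum fun i => ?_).trans
      ((tsum_indicator_norm_le x (by positivity : 0 ≤ 2 * ‖m‖)).trans ?_)
    · by_cases h : (x + latticePt i, m) ∈ largeGrains d S l
      · rw [indicator_of_mem h, indicator_of_mem]
        exact h.2
      · rw [indicator_of_notMem h]
        exact bot_le
    · rw [markWeight, ← ENNReal.ofReal_mul (by positivity)]
      refine ENNReal.ofReal_le_ofReal ?_
      have hm1 : 1 ≤ ‖m‖ := hl'.trans hm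
      have hm0 : 0 < ‖m‖ := by linarith
      -- `4‖m‖ + 1 ≤ 5‖m‖` because `‖m‖ ≥ l ≥ 1`.
      have h1 : (2 * (2 * ‖m‖) + 1) ^ d ≤ 5 ^ d * ‖m‖ ^ d := by
        rw [← mul_pow]
        exact pow_le_pow_left₀ (by positivity) (by linarith) d
      have h2 : ‖m‖ ^ d ≤ (l : ℝ) ^ (-δ) * ‖m‖ ^ ((d : ℝ) + δ) := by
        rw [Real.rpow_add hm0, Real.rpow_natCast, Real.rpow_neg (by linarith)]
        have h3 : (l : ℝ) ^ δ ≤ ‖m‖ ^ δ := Real.rpow_le_rpow (by linarith) hm hδ.le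
        have h4 : 0 < (l : ℝ) ^ δ := Real.rpow_pos_of_pos (by linarith) δ
        rw [inv_mul_eq_div, le_div_iff₀ h4]
        exact mul_le_mul_of_nonneg_left h3 (by positivity)
      have h5 : 0 ≤ (l : ℝ) ^ (-δ) := Real.rpow_nonneg (by linarith) _
      calc _ ≤ 5 ^ d * ‖m‖ ^ d := h1
        _ ≤ 5 ^ d * ((l : ℝ) ^ (-δ) * ‖m‖ ^ ((d : ℝ) + δ)) := by gcongr
        _ ≤ 5 ^ d * (l : ℝ) ^ (-δ) * (1 + ‖m‖ ^ ((d : ℝ) + δ)) := by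
          rw [mul_assoc]
          gcongr
          linarith

/-- Triangle inequality: a common point of `B(x, ‖m‖)` and `B(0, k)` gives `‖x‖ < ‖m‖ + k`, while
`2k + 1 ≤ ‖x‖`. The resulting event no longer depends on `k`, only on `l ≤ k`. -/
theorem compl_underM_subset [MeasurableSpace S] [BorelSpace S] (δ : ℝ) (l : ℕ) :
    (underM d S δ l)ᶜ ⊆
      (tempered d S δ)ᶜ ∪ {γ | 1 ≤ γ.toMeasure (largeGrains d S l)} := by
  intro γ hγ
  by_contra hcon
  rw [mem_union, not_or, notMem_compl_iff] at hcon
  refine hγ ⟨hcon.1, fun k _ hlk x m hxm hx => ?_⟩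
  by_contra hne
  obtain ⟨y, hy1, hy2⟩ := nonempty_iff_ne_empty.2 hne
  refine hcon.2 (γ.one_le_of_ne_zero (measurableSet_largeGrains l) fun h0 => hxm ?_)
  refine measure_mono_null (singleton_subset_iff.2 ?_) h0
  have h1 : 2 * (k : ℝ) + 1 ≤ ‖x‖ := by simpa using hx
  have h2 : ‖y‖ < k := by simpa using hy2
  have h3 : ‖x - y‖ < ‖m‖ := by rw [← dist_eq_norm, dist_comm]; exact hy1
  have h4 : ‖x‖ ≤ ‖x - y‖ + ‖y‖ := by simpa using norm_add_le (x - y) y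
  have h5 : (l : ℝ) ≤ k := by exact_mod_cast hlk
  refine ⟨?_, ?_⟩
  · change 2 * (l : ℝ) + 1 ≤ ‖x‖
    linarith
  · change ‖x‖ ≤ 2 * ‖m‖
    linarith

end LargeGrains

/-! ### Almost sure temperedness of the block laws. -/

section Temperedness

/-- Exponential moments of sums of i.i.d. variables over finite index sets of at least linearly
growing cardinality bound all these sums simultaneously, almost surely. -/
theorem ae_exists_forall_sum_le {ι α : Type*} [MeasurableSpace α] (P : Measure α)
    [IsProbabilityMeasure P] {X : α → ℝ≥0∞} (hX : Measurable X) (hP : ∫⁻ a, eexp (X a) ∂P ≠ ∞)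
    (B : ℕ → Finset ι) (hB : ∀ j, j ≤ (B j).card) :
    ∃ s : ℝ≥0, ∀ᵐ ω ∂(Measure.infinitePi fun _ : ι => P), ∃ T : ℝ≥0,
      ∀ j, ∑ i ∈ B j, X (ω i) ≤ T + (B j).card * s := by
  set M := ∫⁻ a, eexp (X a) ∂P with hM
  have hM1 : 1 ≤ M := by
    calc (1 : ℝ≥0∞) = ∫⁻ _, 1 ∂P := by simp
      _ ≤ M := lintegral_mono fun a => one_le_eexp _
  have h2M0 : 2 * M ≠ 0 := mul_ne_zero two_ne_zero (zero_lt_one.trans_le hM1).ne'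
  have h2M : 2 * M ≠ ∞ := ENNReal.mul_ne_top (by simp) hP
  have hmX : ∀ i : ι, Measurable fun ω : ι → α => eexp (X (ω i)) := fun i =>
    (measurable_eexp.comp hX).comp (measurable_pi_apply i)
  have hprod : ∀ j, ∫⁻ ω, eexp (∑ i ∈ B j, X (ω i)) ∂(Measure.infinitePi fun _ : ι => P) =
      M ^ (B j).card := by
    intro j
    simp_rw [eexp_sum]
    have h := ProbabilityTheory.lintegral_prod_eq_prod_lintegral_of_indepFun (B j)
      (fun (i : ι) (ω : ι → α) => eexp (X (ω i)))
      (ProbabilityTheory.iIndepFun_infinitePi (P := fun _ : ι => P) (X := fun _ a => eexp (X a))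
        fun _ => measurable_eexp.comp hX) hmX
    have hi : ∀ i : ι, ∫⁻ ω, eexp (X (ω i)) ∂(Measure.infinitePi fun _ : ι => P) = M := fun i =>
      (measurePreserving_eval_infinitePi (fun _ : ι => P) i).lintegral_comp
        (measurable_eexp.comp hX)
    simp_rw [h, hi, Finset.prod_const]
  have hms : ∀ j, Measurable fun ω : ι → α => eexp (∑ i ∈ B j, X (ω i)) := fun j =>
    measurable_eexp.comp (Finset.measurable_fun_sum _ fun i _ => hX.comp (measurable_pi_apply i))
  -- By independence the expectation of the exponential is `M ^ card`, so the weight leaves `2 ^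
  -- (-card) ≤ 2 ^ (-j)`, which is summable.
  have hsum : ∫⁻ ω, ∑' j, ((2 * M) ^ (B j).card)⁻¹ * eexp (∑ i ∈ B j, X (ω i))
      ∂(Measure.infinitePi fun _ : ι => P) ≠ ∞ := by
    rw [lintegral_tsum fun j => ((hms j).const_mul _).aemeasurable]
    refine ne_top_of_le_ne_top (b := ∑' j : ℕ, (2⁻¹ : ℝ≥0∞) ^ j) ?_
      (ENNReal.tsum_le_tsum fun j => ?_)
    · rw [ENNReal.tsum_geometric]
      simp
    · rw [lintegral_const_mul _ (hms j), hprod, mul_pow, ENNReal.mul_inv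
        (Or.inl (pow_ne_zero _ two_ne_zero)) (Or.inl (ENNReal.pow_ne_top ENNReal.ofNat_ne_top)),
        mul_assoc, ENNReal.inv_mul_cancel (pow_ne_zero _ (zero_lt_one.trans_le hM1).ne')
          (ENNReal.pow_ne_top hP), mul_one, ← ENNReal.inv_pow]
      exact ENNReal.inv_le_inv.2 (pow_le_pow_right₀ one_le_two (hB j))
  -- With `T` the almost surely finite total of the series, `exp(sum) ≤ T (2M)^card`. Applying `x ≤
  -- e^x` to both `T` and `2M` gives `sum ≤ T + card · 2M` without logarithms.
  refine ⟨(2 * M).toNNReal, ?_⟩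
  filter_upwards [ae_lt_top (Measurable.tsum fun j => (hms j).const_mul _) hsum] with ω hω
  refine ⟨(∑' j, ((2 * M) ^ (B j).card)⁻¹ * eexp (∑ i ∈ B j, X (ω i))).toNNReal, fun j => ?_⟩
  rw [ENNReal.coe_toNNReal hω.ne, ENNReal.coe_toNNReal h2M, ← eexp_le_eexp_iff, eexp_add,
    eexp_natCast_mul]
  have h1 := ENNReal.le_tsum (f := fun j =>
    ((2 * M) ^ (B j).card)⁻¹ * eexp (∑ i ∈ B j, X (ω i))) j
  have h2 : eexp (∑ i ∈ B j, X (ω i)) =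
      (2 * M) ^ (B j).card * (((2 * M) ^ (B j).card)⁻¹ * eexp (∑ i ∈ B j, X (ω i))) := by
    rw [← mul_assoc, ENNReal.mul_inv_cancel (pow_ne_zero _ h2M0) (ENNReal.pow_ne_top h2M), one_mul]
  rw [h2, mul_comm]
  exact mul_le_mul' (h1.trans (le_eexp _)) (pow_le_pow_left' (le_eexp _) _)

variable {d : ℕ} {S : Type*} [NormedAddCommGroup S] [MeasurableSpace S] [BorelSpace S]

theorem measurable_moment_restrict (δ : ℝ) {Λ : Set (Loc d)} (hΛ : MeasurableSet Λ) :
    Measurable fun γ : Config d S => (γ.restrict Λ).moment δ :=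
  Config.measurable_setLIntegral ((measurable_markWeight δ).comp measurable_snd)
    (hΛ.prod MeasurableSet.univ)

theorem measurableSet_tempered (δ : ℝ) : MeasurableSet (tempered d S δ) := by
  refine MeasurableSet.iUnion fun t => ?_
  have : temperedLevel d S δ t = ⋂ (l : ℕ) (_ : 1 ≤ l),
      {γ | (γ.restrict (Metric.ball 0 l)).moment δ ≤ (t : ℝ≥0∞) * (l : ℝ≥0∞) ^ d} := by
    ext γ
    simp [temperedLevel]
  rw [this]
  exact MeasurableSet.iInter fun l => MeasurableSet.iInter fun _ =>
    measurableSet_le (measurable_moment_restrict δ measurableSet_ball) measurable_const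

variable (d) in
/-- The block labels in `[-2j, 2j]^d`. -/
def blockBox (j : ℕ) : Finset (Fin d → ℤ) :=
  Fintype.piFinset fun _ => Finset.Icc (-(2 * j : ℤ)) (2 * j)

theorem card_blockBox (j : ℕ) : (blockBox d j).card = (4 * j + 1) ^ d := by
  rw [blockBox, Fintype.card_piFinset, Finset.prod_const, Finset.card_univ, Fintype.card_fin,
    Int.card_Icc]
  congr 1
  omega

/-- A block meeting the ball after the shift has `2n |κ i| < j + 2n`, hence `|κ i| < 1 + j / 2 ≤
2j`. The box is thus independent of `n` and `y`. -/
theorem moment_restrict_ball_translate_glue_le (δ : ℝ) {n : ℕ} (hn : 1 ≤ n) {y : Loc d}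
    (hy : ∀ i, |y i| ≤ n) {j : ℕ} (hj : 1 ≤ j) (ω : (Fin d → ℤ) → Config d S) :
    (((Config.glue n ω).translate y).restrict (Metric.ball 0 j)).moment δ ≤
      ∑ κ ∈ blockBox d j, ((ω κ).restrict (cube d n)).moment δ := by
  have hb : MeasurableSet (Metric.ball (0 : Loc d) j ×ˢ (univ : Set S)) :=
    measurableSet_ball.prod MeasurableSet.univ
  have hw : Measurable fun p : Pt d S => markWeight d δ p.2 :=
    (measurable_markWeight δ).comp measurable_snd
  set g : Pt d S → ℝ≥0∞ :=
    (Metric.ball (0 : Loc d) j ×ˢ univ).indicator fun p => markWeight d δ p.2 with hg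
  have hgm : Measurable g := hw.indicator hb
  have h1 : (((Config.glue n ω).translate y).restrict (Metric.ball 0 j)).moment δ =
      ∫⁻ p, g p ∂((Config.glue n ω).translate y).toMeasure := (lintegral_indicator hb _).symm
  rw [h1, Config.lintegral_translate _ _ hgm,
    Config.lintegral_glue n ω (f := fun p => g (p.1 + y, p.2)) (hgm.comp (measurable_shift y)),
    tsum_eq_sum (s := blockBox d j)]
  · refine Finset.sum_le_sum fun κ _ => lintegral_mono fun p => ?_
    exact indicator_le_self' (f := fun q : Pt d S => markWeight d δ q.2) (fun _ _ => bot_le) _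
  · intro κ hκ
    refine setLIntegral_eq_zero
      ((measurableSet_cube d n).prod MeasurableSet.univ) fun p hp => ?_
    refine indicator_of_notMem (fun hball => hκ (Fintype.mem_piFinset.2 fun i => ?_)) _
    have h2 : ‖p.1 + (2 * n : ℝ) • latticePt κ + y‖ < j := by simpa using hball
    have h3 : |p.1 i + 2 * n * (κ i : ℝ) + y i| < j := by
      have := (PiLp.norm_apply_le (p.1 + (2 * n : ℝ) • latticePt κ + y) i).trans_lt h2
      simpa [latticePt] using this
    have h4 := hp.1 i
    have h5 := abs_le.1 (hy i)
    have hn' : (1 : ℝ) ≤ n := by exact_mod_cast hn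
    have hj' : (1 : ℝ) ≤ j := by exact_mod_cast hj
    rw [abs_lt] at h3
    have h6 : (κ i : ℝ) ≤ 2 * j := by
      by_contra! h
      nlinarith
    have h7 : -(2 * j : ℝ) ≤ κ i := by
      by_contra! h
      nlinarith
    exact Finset.mem_Icc.2 ⟨by exact_mod_cast h7, by exact_mod_cast h6⟩

theorem ae_mem_tempered_blockLaw (hd : 1 ≤ d) (δ : ℝ) {n : ℕ} (hn : 1 ≤ n)
    (P : Measure (Config d S)) [IsProbabilityMeasure P]
    (hP : ∫⁻ γ, eexp ((γ.restrict (cube d n)).moment δ) ∂P ≠ ∞) {y : Loc d}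
    (hy : ∀ i, |y i| ≤ n) :
    ∀ᵐ γ ∂((blockLaw n P).map (Config.translate y)), γ ∈ tempered d S δ := by
  rw [ae_map_iff (p := fun γ => γ ∈ tempered d S δ) (Config.measurable_translate y).aemeasurable
      (measurableSet_tempered δ),
    blockLaw, ae_map_iff (p := fun γ => γ.translate y ∈ tempered d S δ)
      (Config.measurable_glue n).aemeasurable
      (Config.measurable_translate y (measurableSet_tempered δ))]
  obtain ⟨s, hs⟩ := ae_exists_forall_sum_le P
    (measurable_moment_restrict δ (measurableSet_cube d n)) hP (blockBox d) fun j => by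
      rw [card_blockBox]
      -- `d ≥ 1` enters here: the boxes must grow at least linearly in `j`.
      exact le_trans (by omega) (Nat.le_self_pow (by omega) (4 * j + 1))
  filter_upwards [hs] with ω ⟨T, hT⟩
  -- For `j ≥ 1`, `(4j + 1)^d ≤ 5^d j^d` and `T ≤ T j^d`.
  obtain ⟨t, ht⟩ := exists_nat_ge (T + 5 ^ d * s)
  refine mem_iUnion.2 ⟨t, fun j hj => ?_⟩
  refine (moment_restrict_ball_translate_glue_le δ hn hy hj ω).trans ((hT j).trans ?_)
  rw [card_blockBox]
  have hj' : (1 : ℝ≥0) ≤ j := by exact_mod_cast hj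
  have h1 : T + ((4 * j + 1) ^ d : ℝ≥0) * s ≤ t * j ^ d := by
    have h2 : ((4 * j + 1) ^ d : ℝ≥0) ≤ 5 ^ d * j ^ d := by
      rw [← mul_pow]
      refine pow_le_pow_left₀ (by positivity) ?_ d
      calc (4 * j + 1 : ℝ≥0) ≤ 4 * j + j := by gcongr
        _ = 5 * j := by ring
    calc T + ((4 * j + 1) ^ d : ℝ≥0) * s ≤ T * j ^ d + 5 ^ d * j ^ d * s :=
          add_le_add (le_mul_of_one_le_right' (one_le_pow₀ hj')) (by gcongr)
      _ = (T + 5 ^ d * s) * j ^ d := by ring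
      _ ≤ t * j ^ d := by gcongr
  have h3 := ENNReal.coe_le_coe.2 h1
  push_cast at h3 ⊢
  exact h3

end Temperedness

/-! ### Uniform estimate for the averaged measures. -/

section Main

variable {d : ℕ} {S : Type*} [NormedAddCommGroup S] [MeasurableSpace S] [BorelSpace S]

theorem card_translations (n : ℕ) :
    (Fintype.piFinset fun _ : Fin d => Finset.Ico (-(n : ℤ)) (n : ℤ)).card = (2 * n) ^ d := by
  rw [Fintype.card_piFinset, Finset.prod_const, Finset.card_univ, Fintype.card_fin, Int.card_Ico]
  congr 1
  omega

theorem isProbabilityMeasure_barP {H : EnergyFunctional d S} {z : ℝ≥0} {R : Measure S} {n : ℕ}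
    (hn : 1 ≤ n) [IsProbabilityMeasure (gibbs H z R (cube d n) (isBounded_cube d n))] :
    IsProbabilityMeasure (barP H z R n) := by
  have ht : IsProbabilityMeasure (tildeP H z R n) := isProbabilityMeasure_blockLaw n _
  refine ⟨?_⟩
  have h1 : ∀ κ : Fin d → ℤ, (tildeP H z R n).map (Config.translate (latticePt κ)) univ = 1 :=
    fun κ => by
      rw [Measure.map_apply (Config.measurable_translate _) MeasurableSet.univ, preimage_univ,
        measure_univ]
  rw [barP, Measure.smul_apply, Measure.finsetSum_apply, Finset.sum_congr rfl fun κ _ => h1 κ,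
    Finset.sum_const, card_translations, nsmul_one, smul_eq_mul]
  push_cast
  have hn' : (n : ℝ≥0∞) ≠ 0 := by exact_mod_cast (by omega : n ≠ 0)
  exact ENNReal.inv_mul_cancel (pow_ne_zero _ (mul_ne_zero two_ne_zero hn'))
    (ENNReal.pow_ne_top (ENNReal.mul_ne_top (by simp) (by simp)))

theorem ae_mem_tempered_barP (hd : 1 ≤ d) (δ : ℝ) {H : EnergyFunctional d S} {z : ℝ≥0}
    {R : Measure S} {n : ℕ} (hn : 1 ≤ n)
    [IsProbabilityMeasure (gibbs H z R (cube d n) (isBounded_cube d n))]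
    (hP : ∫⁻ γ, eexp ((γ.restrict (cube d n)).moment δ)
      ∂(gibbs H z R (cube d n) (isBounded_cube d n)) ≠ ∞) :
    barP H z R n (tempered d S δ)ᶜ = 0 := by
  rw [barP, Measure.smul_apply, Measure.finsetSum_apply, Finset.sum_eq_zero, smul_zero]
  intro κ hκ
  refine ae_iff.1 (ae_mem_tempered_blockLaw hd δ hn _ hP fun i => ?_)
  have h := Finset.mem_Ico.1 (Fintype.mem_piFinset.1 hκ i)
  have h1 : |κ i| ≤ n := abs_le.2 ⟨h.1, h.2.le⟩
  simpa [latticePt] using (by exact_mod_cast h1 : |(κ i : ℝ)| ≤ n)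

/-- Markov's inequality for the number of large grains, followed by the periodized intensity bound
and the pointwise lattice count. -/
theorem barP_one_le_largeGrains_le {δ : ℝ} (hδ : 0 < δ) {H : EnergyFunctional d S} {z : ℝ≥0}
    {R : Measure S} {n : ℕ}
    [IsProbabilityMeasure (gibbs H z R (cube d n) (isBounded_cube d n))] {l : ℕ} (hl : 1 ≤ l) :
    barP H z R n {γ | 1 ≤ γ.toMeasure (largeGrains d S l)} ≤
      ((2 * n : ℝ≥0∞) ^ d)⁻¹ * (ENNReal.ofReal (5 ^ d * (l : ℝ) ^ (-δ)) *
        ∫⁻ γ, (γ.restrict (cube d n)).moment δ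
          ∂(gibbs H z R (cube d n) (isBounded_cube d n))) := by
  set P := gibbs H z R (cube d n) (isBounded_cube d n)
  have hD := measurableSet_largeGrains (d := d) (S := S) l
  have hg : Measurable ((largeGrains d S l).indicator fun _ => (1 : ℝ≥0∞)) :=
    measurable_const.indicator hD
  have hw : Measurable fun p : Pt d S => markWeight d δ p.2 :=
    (measurable_markWeight δ).comp measurable_snd
  rw [barP, Measure.smul_apply, Measure.finsetSum_apply, smul_eq_mul]
  refine mul_le_mul_right ?_ _
  refine (Finset.sum_le_sum fun κ _ => ?_).trans
    ((sum_lintegral_translate_blockLaw_le P hg).trans ?_)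
  · have h := mul_meas_ge_le_lintegral (μ := (blockLaw n P).map (Config.translate (latticePt κ)))
      (Config.measurable_apply hD) 1
    rw [one_mul] at h
    refine h.trans_eq (lintegral_congr fun γ => ?_)
    exact (lintegral_indicator_one hD).symm
  · rw [← lintegral_const_mul _ (measurable_moment_restrict δ (measurableSet_cube d n))]
    refine lintegral_mono fun γ => ?_
    rw [Config.moment_eq, ← lintegral_const_mul _ hw]
    exact lintegral_mono fun p => tsum_indicator_largeGrains_le hl hδ p.1 p.2

/-- The averaged measures charge configurations with far-reaching grains with a probability that
tends to `0` uniformly in the volume. -/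
theorem exists_forall_barP_compl_underM_le (hd : 1 ≤ d) {R : Measure S} [IsProbabilityMeasure R]
    {δ : ℝ} (hδ : 0 < δ) (hR : HasSuperExpMoment d δ R) (z : ℝ≥0) {H : EnergyFunctional d S}
    (hH : H.IsStable δ) :
    ∃ C : ℝ≥0, ∀ n : ℕ, 1 ≤ n → IsProbabilityMeasure (barP H z R n) ∧
      ∀ l : ℕ, 1 ≤ l → barP H z R n (underM d S δ l)ᶜ ≤
        ENNReal.ofReal (5 ^ d * (l : ℝ) ^ (-δ)) * C := by
  obtain ⟨c, hc⟩ := hH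
  obtain ⟨K, hK⟩ := WithTop.ne_top_iff_exists.1
    (lintegral_eexp_markWeight_ne_top hd hδ hR (1 + c))
  refine ⟨z * K + 1, fun n hn => ?_⟩
  have hV : (volume : Measure (Loc d)) (cube d n) = (((2 * n) ^ d : ℝ≥0) : ℝ≥0∞) := by
    rw [volume_cube, ← ENNReal.ofReal_coe_nnreal]
    push_cast
    rfl
  have hm := measurableSet_cube d n
  have hb := isBounded_cube d n
  have hprob := isProbabilityMeasure_gibbs z R hc hK.symm hm hb hV
  refine ⟨isProbabilityMeasure_barP hn, fun l hl => ?_⟩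
  refine (measure_mono (compl_underM_subset δ l)).trans ((measure_union_le _ _).trans ?_)
  rw [ae_mem_tempered_barP hd δ hn (ne_top_of_le_ne_top ENNReal.ofReal_ne_top
    (lintegral_eexp_moment_gibbs_le z R hc hK.symm hm hb hV)), zero_add]
  refine (barP_one_le_largeGrains_le hδ hl).trans ?_
  rw [mul_left_comm]
  refine mul_le_mul_right ?_ _
  refine (mul_le_mul_right (lintegral_moment_gibbs_le z R hc hK.symm hm hb hV) _).trans ?_
  have hn1 : (1 : ℝ≥0) ≤ 2 * n := by
    have : (1 : ℝ≥0) ≤ n := by exact_mod_cast hn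
    exact this.trans (le_mul_of_one_le_left' one_le_two)
  -- The additive `1` is absorbed into the volume `(2n)^d ≥ 1`, making the constant uniform in `n`.
  have h1 : (z * (2 * n) ^ d * K + 1 : ℝ≥0) ≤ (2 * n) ^ d * (z * K + 1) := by
    have := one_le_pow₀ (n := d) hn1
    calc (z * (2 * n) ^ d * K + 1 : ℝ≥0) ≤ z * (2 * n) ^ d * K + (2 * n) ^ d := by gcongr
      _ = _ := by ring
  have h2 := ENNReal.coe_le_coe.2 h1
  push_cast at h2 ⊢
  have hn' : (n : ℝ≥0∞) ≠ 0 := by exact_mod_cast (by omega : n ≠ 0)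
  rw [ENNReal.inv_mul_le_iff (pow_ne_zero _ (mul_ne_zero two_ne_zero hn'))
    (ENNReal.pow_ne_top (ENNReal.mul_ne_top (by simp) (by simp)))]
  exact h2

end Main

end MarkedGibbs

end

open MarkedGibbs in
theorem proposition3p5 {d : ℕ} (hd : 1 ≤ d)
    {S : Type*} [NormedAddCommGroup S] [NormedSpace ℝ S] [MeasurableSpace S] [BorelSpace S]
    (R : MeasureTheory.Measure S) [MeasureTheory.IsProbabilityMeasure R]
    (δ : ℝ) (hδ : 0 < δ) (hR : HasSuperExpMoment d δ R)
    (z : NNReal) (hz : 0 < z)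
    (H : EnergyFunctional d S) (hH : H.IsStable δ)
    (ε : ℝ) (hε : 0 < ε) :
    ∃ l : ℕ, 1 ≤ l ∧ ∀ n : ℕ, 1 ≤ n → 1 - ε ≤ (barP H z R n).real (underM d S δ l) := by
  obtain ⟨C, hC⟩ := exists_forall_barP_compl_underM_le hd hδ hR z hH
  have hlim : Filter.Tendsto (fun l : ℕ => 5 ^ d * (l : ℝ) ^ (-δ) * C) Filter.atTop (nhds 0) := by
    simpa using (((tendsto_rpow_neg_atTop hδ).comp tendsto_natCast_atTop_atTop).const_mul
      ((5 : ℝ) ^ d)).mul_const (C : ℝ)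
  obtain ⟨l, hl1, hl⟩ := ((Filter.eventually_ge_atTop 1).and
    (hlim.eventually (ge_mem_nhds hε))).exists
  refine ⟨l, hl1, fun n hn => ?_⟩
  obtain ⟨hprob, hbound⟩ := hC n hn
  have h1 : (barP H z R n).real (underM d S δ l)ᶜ ≤ ε := by
    refine ENNReal.toReal_le_of_le_ofReal hε.le ((hbound l hl1).trans ?_)
    rw [← ENNReal.ofReal_coe_nnreal, ← ENNReal.ofReal_mul (by positivity)]
    exact ENNReal.ofReal_le_ofReal hl
  -- Subadditivity holds for arbitrary sets, so the measurability of `underM` is not needed.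
  have h2 := measureReal_union_le (μ := barP H z R n) (underM d S δ l) (underM d S δ l)ᶜ
  rw [union_compl_self, probReal_univ] at h2
  linarith
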